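/- Let $\mathcal X$ be a measurable space, $p,d\in\mathbb N$, and let $\mathcal D$ be a probability distribution of $(X,Y,Z)$ on $\mathcal X\times\{0,1\}\times[p]$ (features, label, protected attribute). Let $\mathcal F\subseteq\{0,1\}^{\mathcal X\times[p]}$ be a class of VC dimension $d$ of measurable classifiers. As usual for uniform laws of large numbers over $\mathcal F$, assume that for all $n$ and $b\in\{0,1\}^n$ the event that some $f\in\mathcal F$ satisfies $f(X_i,Z_i)=b_i$ for all $i\le n$, for i.i.d. $(X_i,Y_i,Z_i)\sim\mathcal D$, is measurable for the completed product measure. Let $\mathcal E(f),\mathcal E'(f)$ be two events that depend on the classifier $f$ through its prediction, i.e. $\mathcal E(f)=\{(f(X,Z),X,Y,Z)\in E\}$ and $\mathcal E'(f)=\{(f(X,Z),X,Y,Z)\in E'\}$ for fixed measurable sets $E,E'\subseteq\{0,1\}\times\mathcal X\times\{0,1\}\times[p]$. For a distribution $\mu$ put $$\mathrm{Err}_\mu(f)=\Pr_\mu[f(X,Z)\ne Y],\qquad q_\ell(f)=\Pr_\mu[\mathcal E(f)\mid\mathcal E'(f),Z=\ell],\qquad \Omega_\mu(f)=\frac{\min_{\ell\in[p]}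 q_\ell(f)}{\max_{\ell\in[p]} q_\ell(f)},$$ where a conditional probability given a null event and the quotient $0/0$ are read as $0$. Let $\tau\in(0,1]$ and let $f^\star$ minimize $\mathrm{Err}_{\mathcal D}(f)$ over the $f\in\mathcal F$ with $\Omega_{\mathcal D}(f)\ge\tau$. Suppose $\lambda>0$ is such that $\Pr_{\mathcal D}[\mathcal E(f^\star),\mathcal E'(f^\star),Z=\ell]\ge\lambda$ for all $\ell\in[p]$. **Nasty Sample Noise.** $N$ samples are drawn i.i.d. from $\mathcal D$. A randomized, computationally unbounded adversary, who sees all of them and knows everything else, chooses at most $\eta N$ of them and arbitrarily changes their features, labels and protected attributes. The resulting perturbed samples, with empirical distribution $\widehat D$, are given to the learner. **Error-tolerant program.** For a parameter $\Delta>0$: minimize $\mathrm{Err}_{\widehat D}(f)$ over the $f\in\mathcal F$ such that $$\Omega_{\widehat D}(f)\ge\tau\left(\frac{1-(\eta+\Delta)/\lambda}{1+(\eta+\Delta)/\lambda}\right)^2\quad\text{and}\quad \Pr_{\widehat D}[\mathcal E(f),\mathcal E'(f),Z=\ell]\ge\lambda-\eta-\Delta\ \text{ for all }\ell\in[p].$$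 **Theorem.** There is a polynomial $P$ in three variables, independent of all other data, such that the following holds for all $\mathcal X,p,d,\mathcal D,\mathcal F,E,E',\tau,f^\star,\lambda$ as above, all $\eta\in(0,\lambda/2)$, $\varepsilon>2\eta$, $\nu>\frac{8\eta\tau}{\lambda-2\eta}$, $\delta\in(0,1)$, all $\Delta$ with $$0<\Delta\le\min\left\{\frac{(\lambda-2\eta)^2}{96}\cdot\min\Big\{\varepsilon-2\eta,\ \nu-\frac{8\eta\tau}{\lambda-2\eta}\Big\},\ \lambda-2\eta\right\},$$ all $N\ge P\big(d,\tfrac1\Delta,\log\tfrac p\delta\big)$, and all adversaries of the $\eta$-Nasty Sample Noise model: with probability at least $1-\delta$, the error-tolerant program on the $N$ perturbed samples has an optimal solution, and every optimal solution $f_{\mathrm{ET}}$ of it satisfies $$\mathrm{Err}_{\mathcal D}(f_{\mathrm{ET}})-\mathrm{Err}_{\mathcal D}(f^\star)\le\varepsilon\qquad\text{and}\qquad\Omega_{\mathcal D}(f_{\mathrm{ET}})\ge\tau-\nu.$$ (Since the event may fail to be measurable, this means that the complementary event has outer probability at most $\delta$.) -/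

import Mathlib

open MeasureTheory ProbabilityTheory
open scoped ENNReal

universe u v

namespace FairClassification

/-- A data point `(x, y, z)`: features, binary label, protected attribute in `[p]`. -/
abbrev Point (X : Type u) (p : ℕ) : Type u := X × Bool × Fin p

/-- Binary classifiers, which see the features and the protected attribute. -/
abbrev Classifier (X : Type u) (p : ℕ) : Type u := X × Fin p → Bool

variable {X : Type u} {p : ℕ}

/-- The prediction of `f` at the data point `w`; it does not depend on the label of `w`. -/
def predict (f : Classifier X p) (w : Point X p) : Bool := f (w.1, w.2.2)

/-- The event `Z = ℓ`. -/
def groupEvent (X : Type u) {p : ℕ} (ℓ : Fin p) : Set (Point X p) := {w | w.2.2 = ℓ}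

/-- The event `ℰ(f)` about a random data point that is described by a set `E` of pairs
(prediction of the classifier, data point). For instance `ℰ = (f = 1)` is `{v | v.1 = true}`,
`ℰ = (Y = 0)` is `{v | v.2.2.1 = false}`, and the trivial event is `Set.univ`. -/
def eventOf (E : Set (Bool × Point X p)) (f : Classifier X p) : Set (Point X p) :=
  {w | (predict f w, w) ∈ E}

section Metrics

variable [MeasurableSpace X]

/-- `Err_μ(f) = Pr_μ[f(X, Z) ≠ Y]`. -/
noncomputable def err (μ : Measure (Point X p)) (f : Classifier X p) : ℝ :=
  μ.real {w | predict f w ≠ w.2.1}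

/-- `q_ℓ(f) = Pr_μ[ℰ(f) ∣ ℰ'(f), Z = ℓ]` (equal to `0` if the conditioning event is null). -/
noncomputable def performance (E E' : Set (Bool × Point X p)) (μ : Measure (Point X p))
    (f : Classifier X p) (ℓ : Fin p) : ℝ :=
  (ProbabilityTheory.cond μ (eventOf E' f ∩ groupEvent X ℓ)).real (eventOf E f)

/-- `Ω_μ(f) = min_ℓ q_ℓ(f) / max_ℓ q_ℓ(f)` (equal to `0` if all `q_ℓ(f)` vanish). -/
noncomputable def fairness (E E' : Set (Bool × Point X p)) (μ : Measure (Point X p))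
    (f : Classifier X p) : ℝ :=
  (⨅ ℓ, performance E E' μ f ℓ) / (⨆ ℓ, performance E E' μ f ℓ)

/-- `Pr_μ[ℰ(f), ℰ'(f), Z = ℓ]`. -/
noncomputable def jointProb (E E' : Set (Bool × Point X p)) (μ : Measure (Point X p))
    (f : Classifier X p) (ℓ : Fin p) : ℝ :=
  μ.real (eventOf E f ∩ eventOf E' f ∩ groupEvent X ℓ)

/-- The empirical distribution of the samples `s`. -/
noncomputable def empirical {N : ℕ} (s : Fin N → Point X p) : Measure (Point X p) :=
  (N : ℝ≥0∞)⁻¹ • ∑ i, Measure.dirac (s i)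

/-- `f` is an optimal solution of: minimize `Err_μ` over the `f ∈ F` with `Ω_μ(f) ≥ τ`. -/
structure IsOptimalFair (F : Set (Classifier X p)) (E E' : Set (Bool × Point X p)) (τ : ℝ)
    (μ : Measure (Point X p)) (f : Classifier X p) : Prop where
  mem : f ∈ F
  fair : τ ≤ fairness E E' μ f
  optimal : ∀ g ∈ F, τ ≤ fairness E E' μ g → err μ f ≤ err μ g

/-- Feasibility of `f` for the error-tolerant program on the (perturbed) samples `s`. -/
structure ErrTolerantFeasible (F : Set (Classifier X p)) (E E' : Set (Bool × Point X p))
    (τ η lam Δ : ℝ) {N : ℕ} (s : Fin N → Point X p) (f : Classifier X p) : Prop where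
  mem : f ∈ F
  fair : τ * ((1 - (η + Δ) / lam) / (1 + (η + Δ) / lam)) ^ 2 ≤ fairness E E' (empirical s) f
  lower : ∀ ℓ, lam - η - Δ ≤ jointProb E E' (empirical s) f ℓ

/-- `f` is an optimal solution of the error-tolerant program on the (perturbed) samples `s`. -/
def IsErrTolerantOpt (F : Set (Classifier X p)) (E E' : Set (Bool × Point X p))
    (τ η lam Δ : ℝ) {N : ℕ} (s : Fin N → Point X p) (f : Classifier X p) : Prop :=
  ErrTolerantFeasible F E E' τ η lam Δ s f ∧
    ∀ g, ErrTolerantFeasible F E E' τ η lam Δ s g → err (empirical s) f ≤ err (empirical s) g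

/-- `F` is a measurable class for samples from `μ`: its members are measurable, and for every
pattern `b` of `n` predictions the event that some member of `F` realizes `b` on `n` independent
draws from `μ` is measurable with respect to the completed product measure. -/
structure IsMeasurableClass (F : Set (Classifier X p)) (μ : Measure (Point X p)) : Prop where
  measurable : ∀ f ∈ F, Measurable f
  pattern : ∀ (n : ℕ) (b : Fin n → Bool),
    NullMeasurableSet {s : Fin n → Point X p | ∃ f ∈ F, ∀ i, predict f (s i) = b i}
      (Measure.pi fun _ : Fin n => μ)

/-- The `η`-Nasty Sample Noise model for `N` samples, as a joint law: under `P` the true samples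
`S` are `N` independent draws from `μ`, and the samples `T` that the randomized adversary hands out
differ from `S`, in features, labels or protected attributes, at no more than `η * N` indices.
`T` may depend on all of `S` and on any further randomness. -/
structure IsNastyNoise {Ω : Type v} [MeasurableSpace Ω] (P : Measure Ω) (μ : Measure (Point X p))
    (η : ℝ) {N : ℕ} (S T : Ω → Fin N → Point X p) : Prop where
  law : HasLaw S (Measure.pi fun _ : Fin N => μ) P
  budget : ∀ᵐ ω ∂P, ({i | T ω i ≠ S ω i}.ncard : ℝ) ≤ η * N

end Metrics

/-- `F` shatters the finite set `B`: every subset of `B` is cut out by some `f ∈ F`. -/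
def Shatters (F : Set (Classifier X p)) (B : Finset (X × Fin p)) : Prop :=
  ∀ C ⊆ B, ∃ f ∈ F, ∀ a ∈ B, f a = true ↔ a ∈ C

/-- `d` is the largest size of a finite set that is shattered by `F`. -/
def HasVCDim (F : Set (Classifier X p)) (d : ℕ) : Prop :=
  IsGreatest {k | ∃ B : Finset (X × Fin p), B.card = k ∧ Shatters F B} d

end FairClassification

namespace FairClassification

/-! ### Growth of a VC class on finitely many points. -/

section Combinatorics

/-! The program sees a classifier only through the probabilities of 2p + 1 events: misclassification
and, for each group, the joint and the conditioning event. Uniform convergence over the VC class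
(`measure_deviationEvent_le`) makes all their frequencies on the clean sample Δ-accurate; altering
ηN points moves each by at most η more. So, with high probability, the perturbed empirical
distribution is within α = η + Δ of the true one on all these events, whatever the adversary did
(`programClose_empirical`).

The rest is deterministic (`errTolerant_guarantee`). Above a floor λ an additive error α is a
relative error α/λ, so `fStar` meets the relaxed constraints. An optimal solution then loses at most
2α in true error. Its empirical joint probabilities are at least λ - α, so its empirical fairness
carries over to the true distribution at a further factor (1 - 2α/λ)².

Uniform convergence is proved by symmetrization: a ghost sample, random swaps, Sauer–Shelah and
Hoeffding. -/

theorem sum_choose_le_succ_pow (m d : ℕ) :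
    ∑ k ∈ Finset.Iic d, m.choose k ≤ (m + 1) ^ d := by
  rw [add_pow, ← Nat.range_succ_eq_Iic]
  refine Finset.sum_le_sum fun k hk => ?_
  have hk' : k ≤ d := Nat.lt_succ_iff.1 (Finset.mem_range.1 hk)
  have := Nat.choose_pos hk'
  calc m.choose k ≤ m ^ k := Nat.choose_le_pow m k
    _ ≤ m ^ k * 1 ^ (d - k) * d.choose k := by
      rw [one_pow, mul_one]; exact Nat.le_mul_of_pos_right _ this

variable {X : Type u} {p : ℕ}

/-- Sauer–Shelah for the restriction of `F` to a finite family of points. -/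
theorem card_patterns_le {F : Set (Classifier X p)} {d : ℕ} (hF : HasVCDim F d)
    {ι : Type*} [Fintype ι] (x : ι → X × Fin p) (B : Finset (ι → Bool))
    (hB : ∀ b ∈ B, ∃ f ∈ F, ∀ i, f (x i) = b i) :
    B.card ≤ (Fintype.card ι + 1) ^ d := by
  classical
  let supp : (ι → Bool) → Finset ι := fun b => Finset.univ.filter fun i => b i = true
  have hinj : Function.Injective supp := by
    intro b c h
    funext i
    have := congrArg (i ∈ ·) h
    simp only [supp, Finset.mem_filter, Finset.mem_univ, true_and, eq_iff_iff] at this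
    exact Bool.eq_iff_iff.2 this
  rw [← Finset.card_image_of_injective B hinj]
  refine (Finset.card_le_card_shatterer _).trans (Finset.card_shatterer_le_sum_vcDim.trans ?_)
  refine le_trans ?_ (sum_choose_le_succ_pow _ d)
  refine Finset.sum_le_sum_of_subset (Finset.Iic_subset_Iic.2 (Finset.sup_le fun s hs => ?_))
  rw [Finset.mem_shatterer] at hs
  have key : ∀ t ⊆ s, ∃ f ∈ F, ∀ i ∈ s, f (x i) = true ↔ i ∈ t := by
    intro t ht
    obtain ⟨u, hu, hut⟩ := hs ht
    obtain ⟨b, hb, rfl⟩ := Finset.mem_image.1 hu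
    obtain ⟨f, hf, hfb⟩ := hB b hb
    refine ⟨f, hf, fun i hi => ?_⟩
    rw [← hut, hfb i]
    simp [supp, hi]
  -- Repeated points cannot be shattered: a classifier realizing {i} tells x i from every other x j.
  have hxinj : Set.InjOn x s := by
    intro i hi j hj hij
    obtain ⟨f, -, hf⟩ := key {i} (by simpa using hi)
    have h1 := hf i hi
    have h2 := hf j hj
    rw [← hij, h1] at h2
    simpa [eq_comm] using h2
  refine hF.2 ⟨s.image x, Finset.card_image_of_injOn hxinj, fun C hC => ?_⟩
  obtain ⟨f, hf, hfs⟩ := key (s.filter fun i => x i ∈ C) (Finset.filter_subset _ _)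
  refine ⟨f, hf, fun a ha => ?_⟩
  obtain ⟨i, hi, rfl⟩ := Finset.mem_image.1 ha
  rw [hfs i hi]
  simp [hi]

end Combinatorics

/-! ### Hoeffding's inequality for random signs. -/

section Rademacher

variable {ι : Type*} [Fintype ι] [DecidableEq ι]

theorem sum_exp_signs_le (a : ι → ℝ) (ha : ∀ i, |a i| ≤ 1) (s : ℝ) :
    ∑ σ : ι → Bool, Real.exp (s * ∑ i, if σ i then a i else -a i) ≤
      2 ^ Fintype.card ι * Real.exp (Fintype.card ι * s ^ 2 / 2) := by
  have h1 : ∀ σ : ι → Bool, Real.exp (s * ∑ i, if σ i then a i else -a i) =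
      ∏ i, Real.exp (s * if σ i then a i else -a i) := by
    intro σ; rw [Finset.mul_sum, Real.exp_sum]
  simp_rw [h1]
  rw [← Fintype.prod_sum (fun (i : ι) (c : Bool) => Real.exp (s * if c then a i else -a i))]
  have h2 : ∀ i, ∑ c : Bool, Real.exp (s * if c then a i else -a i) ≤
      2 * Real.exp (s ^ 2 / 2) := by
    intro i
    have h3 := Real.cosh_le_exp_half_sq (s * a i)
    rw [Real.cosh_eq] at h3
    have h4 : (s * a i) ^ 2 / 2 ≤ s ^ 2 / 2 := by
      have := (sq_le_one_iff_abs_le_one (a i)).2 (ha i)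
      rw [mul_pow]
      nlinarith [sq_nonneg s]
    have h5 := Real.exp_le_exp.2 h4
    simp only [Fintype.sum_bool, if_true, Bool.false_eq_true, if_false, mul_neg]
    linarith
  calc _ ≤ ∏ _i : ι, 2 * Real.exp (s ^ 2 / 2) :=
        Finset.prod_le_prod (fun i _ => by positivity) fun i _ => h2 i
    _ = _ := by
      rw [Finset.prod_const, mul_pow, ← Real.exp_nat_mul, Finset.card_univ, mul_div_assoc]

/-- Hoeffding's inequality for a signed sum, as a count of sign patterns. -/
theorem card_signs_le (a : ι → ℝ) (ha : ∀ i, |a i| ≤ 1) {ε : ℝ} (hε : 0 ≤ ε) :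
    (((Finset.univ : Finset (ι → Bool)).filter fun σ =>
      ε * Fintype.card ι ≤ |∑ i, if σ i then a i else -a i|).card : ℝ) ≤
      2 ^ Fintype.card ι * (2 * Real.exp (-(Fintype.card ι * ε ^ 2 / 2))) := by
  set n : ℝ := (Fintype.card ι : ℝ)
  set r : (ι → Bool) → ℝ := fun σ => ∑ i, if σ i then a i else -a i
  -- Chernoff bound for both tails, with the optimal parameter s = ε.
  have hpos : ∀ σ, (if ε * n ≤ |r σ| then (1 : ℝ) else 0) ≤
      Real.exp (-(ε * (ε * n))) * (Real.exp (ε * r σ) + Real.exp (-ε * r σ)) := by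
    intro σ
    split_ifs with h
    · rw [mul_add, ← Real.exp_add, ← Real.exp_add]
      rcases le_abs.1 h with h | h
      · have : 1 ≤ Real.exp (-(ε * (ε * n)) + ε * r σ) :=
          Real.one_le_exp (by nlinarith)
        linarith [Real.exp_pos (-(ε * (ε * n)) + -ε * r σ)]
      · have : 1 ≤ Real.exp (-(ε * (ε * n)) + -ε * r σ) :=
          Real.one_le_exp (by nlinarith)
        linarith [Real.exp_pos (-(ε * (ε * n)) + ε * r σ)]
    · positivity
  rw [Finset.card_filter]
  push_cast
  calc _ ≤ ∑ σ, Real.exp (-(ε * (ε * n))) * (Real.exp (ε * r σ) + Real.exp (-ε * r σ)) :=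
        Finset.sum_le_sum fun σ _ => hpos σ
    _ = Real.exp (-(ε * (ε * n))) * (∑ σ, Real.exp (ε * r σ) + ∑ σ, Real.exp (-ε * r σ)) := by
        rw [← Finset.mul_sum, Finset.sum_add_distrib]
    _ ≤ Real.exp (-(ε * (ε * n))) * (2 ^ Fintype.card ι * Real.exp (n * ε ^ 2 / 2) +
          2 ^ Fintype.card ι * Real.exp (n * (-ε) ^ 2 / 2)) := by
        gcongr
        · exact sum_exp_signs_le a ha ε
        · exact sum_exp_signs_le a ha (-ε)
    _ = _ := by
        have : Real.exp (-(n * ε ^ 2 / 2)) =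
            Real.exp (-(ε * (ε * n))) * Real.exp (n * ε ^ 2 / 2) := by
          rw [← Real.exp_add]; congr 1; ring
        rw [this, neg_sq]; ring

end Rademacher

/-! ### Uniform convergence by symmetrization. -/

section Symmetrization

variable {X : Type u} {p : ℕ}

/-- The indicator of `ℰ(f)`. -/
noncomputable def score (G : Set (Bool × Point X p)) (f : Classifier X p) (w : Point X p) : ℝ :=
  G.indicator 1 (predict f w, w)

theorem score_eq_indicator (G : Set (Bool × Point X p)) (f : Classifier X p) :
    score G f = (eventOf G f).indicator 1 := rfl

theorem abs_indicator_one_sub_le {α : Type*} (G : Set α) (x y : α) :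
    |G.indicator (1 : α → ℝ) x - G.indicator 1 y| ≤ 1 := by
  classical
  simp only [Set.indicator_apply, Pi.one_apply]
  split_ifs <;> norm_num

/-- The permutation of a double sample that swaps the entries selected by `σ`. -/
def swapPerm {ι : Type*} (σ : ι → Bool) : Equiv.Perm (ι ⊕ ι) :=
  Function.Involutive.toPerm
    (Sum.elim (fun i => if σ i then .inl i else .inr i) (fun i => if σ i then .inr i else .inl i))
    (by rintro (i | i) <;> cases h : σ i <;> simp [h])

theorem swapPerm_inl {ι : Type*} (σ : ι → Bool) (i : ι) :
    swapPerm σ (.inl i) = if σ i then .inl i else .inr i := rfl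

theorem swapPerm_inr {ι : Type*} (σ : ι → Bool) (i : ι) :
    swapPerm σ (.inr i) = if σ i then .inr i else .inl i := rfl

/-- Double samples on whose halves the frequencies of `ℰ(f)` are `ε` apart for some `f ∈ F`. -/
def ghostEvent (F : Set (Classifier X p)) (G : Set (Bool × Point X p)) (ε : ℝ) (ι : Type*)
    [Fintype ι] : Set (ι ⊕ ι → Point X p) :=
  {w | ∃ f ∈ F, ε * Fintype.card ι ≤ |∑ i, (score G f (w (.inl i)) - score G f (w (.inr i)))|}

/-- Once the double sample is fixed, a swap only flips signs in the sum of differences, and f enters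
only through its predictions on the 2n points. A union bound over the at most (2n + 1)^d patterns
reduces the count to `card_signs_le`. -/
theorem card_swaps_le {F : Set (Classifier X p)} {d : ℕ} (hd : HasVCDim F d)
    (G : Set (Bool × Point X p)) {ε : ℝ} (hε : 0 ≤ ε) {ι : Type*} [Fintype ι] [DecidableEq ι] (w : ι ⊕ ι → Point X p)
    [DecidablePred fun σ : ι → Bool => w ∘ swapPerm σ ∈ ghostEvent F G ε ι] :
    (((Finset.univ : Finset (ι → Bool)).filter fun σ =>
      w ∘ swapPerm σ ∈ ghostEvent F G ε ι).card : ℝ) ≤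
      2 ^ Fintype.card ι * ((2 * Fintype.card ι + 1) ^ d *
        (2 * Real.exp (-(Fintype.card ι * ε ^ 2 / 2)))) := by
  classical
  set B : Finset (ι ⊕ ι → Bool) := Finset.univ.filter fun b =>
    ∃ f ∈ F, ∀ j, predict f (w j) = b j with hBdef
  set a : (ι ⊕ ι → Bool) → ι → ℝ := fun b i =>
    G.indicator 1 (b (.inl i), w (.inl i)) - G.indicator 1 (b (.inr i), w (.inr i)) with ha
  have hsub : (Finset.univ.filter fun σ : ι → Bool => w ∘ swapPerm σ ∈ ghostEvent F G ε ι) ⊆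
      B.biUnion fun b => Finset.univ.filter fun σ : ι → Bool =>
        ε * Fintype.card ι ≤ |∑ i, if σ i then a b i else -a b i| := by
    intro σ hσ
    obtain ⟨f, hf, h⟩ := (Finset.mem_filter.1 hσ).2
    refine Finset.mem_biUnion.2 ⟨fun j => predict f (w j), ?_, ?_⟩
    · exact Finset.mem_filter.2 ⟨Finset.mem_univ _, f, hf, fun _ => rfl⟩
    · refine Finset.mem_filter.2 ⟨Finset.mem_univ _, h.trans_eq ?_⟩
      congr 1
      refine Finset.sum_congr rfl fun i _ => ?_
      cases hi : σ i <;> simp [score, ha, swapPerm_inl, swapPerm_inr, hi]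
  have hB : B.card ≤ (Fintype.card (ι ⊕ ι) + 1) ^ d :=
    card_patterns_le hd (fun j => ((w j).1, (w j).2.2)) B fun b hb => (Finset.mem_filter.1 hb).2
  rw [Fintype.card_sum, ← two_mul] at hB
  calc _ ≤ ((B.biUnion fun b => Finset.univ.filter fun σ : ι → Bool =>
        ε * Fintype.card ι ≤ |∑ i, if σ i then a b i else -a b i|).card : ℝ) := by
        exact_mod_cast Finset.card_le_card hsub
    _ ≤ ∑ b ∈ B, ((Finset.univ.filter fun σ : ι → Bool =>
        ε * Fintype.card ι ≤ |∑ i, if σ i then a b i else -a b i|).card : ℝ) := by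
        exact_mod_cast Finset.card_biUnion_le
    _ ≤ ∑ _b ∈ B, 2 ^ Fintype.card ι * (2 * Real.exp (-(Fintype.card ι * ε ^ 2 / 2))) :=
        Finset.sum_le_sum fun b _ => card_signs_le (a b)
          (fun i => abs_indicator_one_sub_le G _ _) hε
    _ = (B.card : ℝ) * (2 ^ Fintype.card ι *
          (2 * Real.exp (-(Fintype.card ι * ε ^ 2 / 2)))) := by
        rw [Finset.sum_const, nsmul_eq_mul]
    _ ≤ (2 * Fintype.card ι + 1) ^ d * (2 ^ Fintype.card ι *
          (2 * Real.exp (-(Fintype.card ι * ε ^ 2 / 2)))) := by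
        gcongr; exact_mod_cast hB
    _ = _ := by ring

variable [MeasurableSpace X]

theorem measurePreserving_comp_perm {ι W : Type*} [Fintype ι] [MeasurableSpace W]
    (μ : Measure W) [SigmaFinite μ] (e : Equiv.Perm ι) :
    MeasurePreserving (fun w : ι → W => w ∘ e.symm) (Measure.pi fun _ => μ)
      (Measure.pi fun _ => μ) := by
  have h := measurePreserving_piCongrLeft (fun _ : ι => μ) e
  convert h using 1
  funext w
  funext i
  obtain ⟨j, rfl⟩ := e.surjective i
  simp [MeasurableEquiv.coe_piCongrLeft, Equiv.piCongrLeft_apply_apply]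

variable {μ : Measure (Point X p)} [IsProbabilityMeasure μ] {F : Set (Classifier X p)}

theorem nullMeasurableSet_pattern (hF : IsMeasurableClass F μ) {ι : Type*} [Fintype ι]
    (b : ι → Bool) :
    NullMeasurableSet {s : ι → Point X p | ∃ f ∈ F, ∀ i, predict f (s i) = b i}
      (Measure.pi fun _ => μ) := by
  have e := Fintype.equivFin ι
  have h := measurePreserving_piCongrLeft (fun _ : Fin (Fintype.card ι) => μ) e
  have hn := (hF.pattern _ (b ∘ e.symm)).preimage h.quasiMeasurePreserving
  convert hn using 1
  ext s
  simp only [Set.mem_ofPred_eq, Set.mem_preimage]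
  refine exists_congr fun f => and_congr_right fun _ => ?_
  rw [← e.forall_congr_right]
  simp [MeasurableEquiv.coe_piCongrLeft, Equiv.piCongrLeft_apply_apply]

/-- The possibly uncountable union over F becomes a finite union over prediction patterns, each
covered by `IsMeasurableClass`. -/
theorem nullMeasurableSet_ghostEvent (hF : IsMeasurableClass F μ) {G : Set (Bool × Point X p)}
    (hG : MeasurableSet G) (ε : ℝ) (ι : Type*) [Fintype ι] :
    NullMeasurableSet (ghostEvent F G ε ι) (Measure.pi fun _ => μ) := by
  have : ghostEvent F G ε ι = ⋃ b : ι ⊕ ι → Bool,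
      {w | ∃ f ∈ F, ∀ i, predict f (w i) = b i} ∩
      {w | ε * Fintype.card ι ≤
        |∑ i, (G.indicator (1 : Bool × Point X p → ℝ) (b (.inl i), w (.inl i)) -
        G.indicator 1 (b (.inr i), w (.inr i)))|} := by
    ext w
    simp only [ghostEvent, score, Set.mem_ofPred_eq, Set.mem_iUnion, Set.mem_inter_iff]
    constructor
    · rintro ⟨f, hf, h⟩
      exact ⟨fun i => predict f (w i), ⟨f, hf, fun _ => rfl⟩, h⟩
    · rintro ⟨b, ⟨f, hf, hb⟩, h⟩
      exact ⟨f, hf, by simpa only [hb] using h⟩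
  rw [this]
  classical
  refine .iUnion fun b => (nullMeasurableSet_pattern hF b).inter ?_
  have hm : ∀ j, Measurable fun w : ι ⊕ ι → Point X p =>
      G.indicator (1 : Bool × Point X p → ℝ) (b j, w j) := fun j =>
    (measurable_one.indicator hG).comp (measurable_const.prodMk (measurable_pi_apply j))
  exact (measurableSet_le measurable_const ((Finset.measurable_sum _ fun i _ =>
    (hm _).sub (hm _)).abs)).nullMeasurableSet

/-- Swaps preserve the product measure, so the probability equals its average over all swaps, which
`card_swaps_le` bounds pointwise. -/
theorem measure_ghostEvent_le (hF : IsMeasurableClass F μ) {d : ℕ} (hd : HasVCDim F d)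
    {G : Set (Bool × Point X p)} (hG : MeasurableSet G) {ε : ℝ} (hε : 0 ≤ ε) (ι : Type*)
    [Fintype ι] :
    (Measure.pi fun _ => μ) (ghostEvent F G ε ι) ≤
      ENNReal.ofReal ((2 * Fintype.card ι + 1) ^ d *
        (2 * Real.exp (-(Fintype.card ι * ε ^ 2 / 2)))) := by
  classical
  set M := ghostEvent F G ε ι
  set C : ℝ := (2 * Fintype.card ι + 1) ^ d * (2 * Real.exp (-(Fintype.card ι * ε ^ 2 / 2)))
  have hM : NullMeasurableSet M (Measure.pi fun _ => μ) := nullMeasurableSet_ghostEvent hF hG ε ι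
  have hmp : ∀ σ : ι → Bool, MeasurePreserving (fun w : ι ⊕ ι → Point X p => w ∘ swapPerm σ)
      (Measure.pi fun _ => μ) (Measure.pi fun _ => μ) := fun σ =>
    measurePreserving_comp_perm μ (swapPerm σ)
  have hMσ : ∀ σ : ι → Bool, NullMeasurableSet ((fun w => w ∘ swapPerm σ) ⁻¹' M)
      (Measure.pi fun _ => μ) := fun σ => hM.preimage (hmp σ).quasiMeasurePreserving
  have h : (2 : ℝ≥0∞) ^ Fintype.card ι * (Measure.pi fun _ => μ) M ≤
      2 ^ Fintype.card ι * ENNReal.ofReal C := by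
    calc (2 : ℝ≥0∞) ^ Fintype.card ι * (Measure.pi fun _ => μ) M
        = ∑ σ : ι → Bool, (Measure.pi fun _ => μ) ((fun w => w ∘ swapPerm σ) ⁻¹' M) := by
          simp_rw [fun σ => (hmp σ).measure_preimage hM]
          simp
      _ = ∫⁻ w, ∑ σ : ι → Bool, ((fun w => w ∘ swapPerm σ) ⁻¹' M).indicator 1 w
            ∂(Measure.pi fun _ => μ) := by
          refine Eq.trans ?_ (lintegral_finsetSum' _ fun σ _ =>
            (aemeasurable_const (b := (1 : ℝ≥0∞))).indicator₀ (hMσ σ)).symm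
          exact Finset.sum_congr rfl fun σ _ => (lintegral_indicator_one₀ (hMσ σ)).symm
      _ ≤ ∫⁻ _, 2 ^ Fintype.card ι * ENNReal.ofReal C ∂(Measure.pi fun _ => μ) := by
          refine lintegral_mono fun w => ?_
          have h1 := card_swaps_le hd G hε w
          have h2 := ENNReal.ofReal_le_ofReal h1
          rw [ENNReal.ofReal_mul (by positivity), ENNReal.ofReal_natCast,
            ENNReal.ofReal_pow (by norm_num), ENNReal.ofReal_ofNat] at h2
          refine le_trans (le_of_eq ?_) h2
          simp only [Set.indicator_apply, Set.mem_preimage, Pi.one_apply, Finset.sum_boole]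
          rfl
      _ = _ := by simp
  rwa [ENNReal.mul_le_mul_iff_right (by positivity) (by finiteness)] at h

/-- Chebyshev, with variance at most n/4. It serves a single classifier on the ghost sample, where
probability 1/2 suffices. -/
theorem measure_frequency_deviation_le {W : Type*} [MeasurableSpace W] (μ : Measure W)
    [IsProbabilityMeasure μ] {A : Set W} (hA : MeasurableSet A) {ε : ℝ} (hε : 0 < ε)
    (ι : Type*) [Fintype ι] (hn : 1 / (2 * ε ^ 2) ≤ (Fintype.card ι : ℝ)) :
    (Measure.pi fun _ : ι => μ) {s | ε * Fintype.card ι ≤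
      |∑ i, A.indicator (1 : W → ℝ) (s i) - Fintype.card ι * μ.real A|} ≤ 1 / 2 := by
  set n : ℝ := (Fintype.card ι : ℝ)
  have hn0 : 0 < n := lt_of_lt_of_le (by positivity) hn
  set g : W → ℝ := A.indicator 1
  have hg : Measurable g := measurable_one.indicator hA
  have hg01 : ∀ w, g w ∈ Set.Icc (0 : ℝ) 1 := fun w => by
    by_cases h : w ∈ A <;> simp [g, h]
  have hL : MemLp g 2 μ := MemLp.of_bound hg.aestronglyMeasurable 1
    (.of_forall fun w => by
      rw [Real.norm_eq_abs, abs_le]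
      constructor <;> linarith [(hg01 w).1, (hg01 w).2])
  have hL' : ∀ i : ι, MemLp (fun s : ι → W => g (s i)) 2 (Measure.pi fun _ => μ) := fun i =>
    hL.comp_measurePreserving (measurePreserving_eval (fun _ : ι => μ) i)
  have hmean : ∫ s, (∑ i, fun s : ι → W => g (s i)) s ∂(Measure.pi fun _ : ι => μ) =
      n * μ.real A := by
    simp only [Finset.sum_apply]
    rw [integral_finsetSum _ fun i _ => (hL' i).integrable (by norm_num)]
    have : ∀ i : ι, ∫ s, g (s i) ∂(Measure.pi fun _ : ι => μ) = μ.real A := by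
      intro i
      rw [integral_comp_eval (μ := fun _ : ι => μ) hg.aestronglyMeasurable]
      exact integral_indicator_one hA
    simp [this, n]
  have hvar : Var[∑ i, fun s : ι → W => g (s i); Measure.pi fun _ : ι => μ] ≤ n * (1 / 4) := by
    rw [variance_sum_pi (X := fun _ : ι => g) fun _ => hL]
    have := variance_le_sq_of_bounded (μ := μ) (X := g) (.of_forall hg01) hg.aemeasurable
    rw [Finset.sum_const, Finset.card_univ, nsmul_eq_mul]
    gcongr
    exact this.trans_eq (by norm_num)
  have hL2 : MemLp (∑ i, fun s : ι → W => g (s i)) 2 (Measure.pi fun _ : ι => μ) :=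
    memLp_finsetSum' _ fun i _ => hL' i
  have hcheb := meas_ge_le_variance_div_sq hL2 (c := ε * n) (by positivity)
  rw [hmean] at hcheb
  simp only [Finset.sum_apply] at hcheb
  refine hcheb.trans ?_
  rw [show (1 / 2 : ℝ≥0∞) = ENNReal.ofReal (1 / 2) by
    rw [ENNReal.ofReal_div_of_pos (by norm_num)]; simp]
  refine ENNReal.ofReal_le_ofReal ?_
  rw [div_le_iff₀ (by positivity)]
  refine hvar.trans ?_
  rw [div_le_iff₀ (by positivity)] at hn
  nlinarith

/-- Samples on which the frequency of `ℰ(f)` is off by more than `Δ` for some `f ∈ F`. -/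
def deviationEvent (F : Set (Classifier X p)) (μ : Measure (Point X p))
    (G : Set (Bool × Point X p)) (Δ : ℝ) (ι : Type*) [Fintype ι] : Set (ι → Point X p) :=
  {s | ∃ f ∈ F, Δ * Fintype.card ι <
    |∑ i, score G f (s i) - Fintype.card ι * μ.real (eventOf G f)|}

theorem measurable_predict {f : Classifier X p} (hf : Measurable f) : Measurable (predict f) :=
  hf.comp (measurable_fst.prodMk measurable_snd.snd)

theorem measurableSet_eventOf {G : Set (Bool × Point X p)} (hG : MeasurableSet G)
    {f : Classifier X p} (hf : Measurable f) : MeasurableSet (eventOf G f) :=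
  ((measurable_predict hf).prodMk measurable_id) hG

/-- Uniform convergence over a class of finite VC dimension. -/
theorem measure_deviationEvent_le (hF : IsMeasurableClass F μ) {d : ℕ} (hd : HasVCDim F d)
    {G : Set (Bool × Point X p)} (hG : MeasurableSet G) {Δ : ℝ} (hΔ : 0 < Δ) (ι : Type*)
    [Fintype ι] (hn : 2 / Δ ^ 2 ≤ (Fintype.card ι : ℝ)) :
    (Measure.pi fun _ => μ) (deviationEvent F μ G Δ ι) ≤
      ENNReal.ofReal (4 * (2 * Fintype.card ι + 1) ^ d *
        Real.exp (-(Fintype.card ι * Δ ^ 2 / 8))) := by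
  set π : Measure (ι → Point X p) := Measure.pi fun _ => μ
  -- If f deviates by more than Δ on s and by less than Δ/2 on t, the two halves are Δ/2 apart. The
  -- latter has probability at least 1/2 in t, which costs a factor 2.
  set M : Set ((ι → Point X p) × (ι → Point X p)) :=
    {v | Sum.elim v.1 v.2 ∈ ghostEvent F G (Δ / 2) ι}
  have hmp := measurePreserving_sumPiEquivProdPi_symm (fun _ : ι ⊕ ι => μ)
  have hM : (π.prod π) M = (Measure.pi fun _ => μ) (ghostEvent F G (Δ / 2) ι) := by
    rw [← hmp.measure_preimage (nullMeasurableSet_ghostEvent hF hG (Δ / 2) ι)]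
    congr 1
  have hslice : deviationEvent F μ G Δ ι ⊆
      {s | (1 / 2 : ℝ≥0∞) ≤ π (Prod.mk s ⁻¹' toMeasurable (π.prod π) M)} := by
    rintro s ⟨f, hf, hs⟩
    have hA := measurableSet_eventOf hG (hF.measurable f hf)
    have hc := measure_frequency_deviation_le μ hA (ε := Δ / 2) (by positivity) ι
      (by convert hn using 1; field_simp)
    set D : Set (ι → Point X p) := {t | Δ / 2 * Fintype.card ι ≤
      |∑ i, (eventOf G f).indicator (1 : Point X p → ℝ) (t i) -
        Fintype.card ι * μ.real (eventOf G f)|}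
    have h1 : (1 : ℝ≥0∞) ≤ π D + π Dᶜ := by
      rw [← measure_univ (μ := π), ← Set.union_compl_self D]
      exact measure_union_le _ _
    have h2 : Dᶜ ⊆ Prod.mk s ⁻¹' toMeasurable (π.prod π) M := by
      intro t ht
      refine subset_toMeasurable _ _ (show Sum.elim s t ∈ ghostEvent F G (Δ / 2) ι from
        ⟨f, hf, ?_⟩)
      have ht' : |∑ i, (eventOf G f).indicator (1 : Point X p → ℝ) (t i) -
        Fintype.card ι * μ.real (eventOf G f)| < Δ / 2 * Fintype.card ι := not_le.1 ht
      rw [← score_eq_indicator] at ht'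
      simp only [Sum.elim_inl, Sum.elim_inr, Finset.sum_sub_distrib]
      have := abs_sub_abs_le_abs_sub
        (∑ i, score G f (s i) - Fintype.card ι * μ.real (eventOf G f))
        (∑ i, score G f (t i) - Fintype.card ι * μ.real (eventOf G f))
      rw [sub_sub_sub_cancel_right] at this
      linarith
    refine le_trans ?_ (measure_mono h2)
    by_contra hlt
    have h3 : π D + π Dᶜ < 1 / 2 + 1 / 2 :=
      ENNReal.add_lt_add_of_le_of_lt (ne_top_of_le_ne_top (b := 1 / 2) (by finiteness) hc) hc
        (not_le.1 hlt)
    rw [ENNReal.add_halves] at h3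
    exact absurd h1 (not_le.2 h3)
  -- Markov's inequality on slice measures. Passing to a measurable hull of M allows Tonelli and
  -- leaves the deviation event itself free of any measurability requirement.
  have hmeas := measurableSet_toMeasurable (π.prod π) M
  have hmarkov := mul_meas_ge_le_lintegral (μ := π)
    (measurable_measure_prodMk_left (ν := π) hmeas) (1 / 2)
  rw [← Measure.prod_apply hmeas, measure_toMeasurable, hM] at hmarkov
  have hghost := measure_ghostEvent_le hF hd hG (ε := Δ / 2) (by positivity) ι
  have hfin := hmarkov.trans hghost
  calc π (deviationEvent F μ G Δ ι)
      ≤ 2 * (1 / 2 * π {s | (1 / 2 : ℝ≥0∞) ≤ π (Prod.mk s ⁻¹' toMeasurable (π.prod π) M)}) := by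
        rw [← mul_assoc, one_div, ENNReal.mul_inv_cancel (by simp) (by simp), one_mul, ← one_div]
        exact measure_mono hslice
    _ ≤ 2 * ENNReal.ofReal _ := by gcongr
    _ = _ := by
        rw [← ENNReal.ofReal_ofNat 2, ← ENNReal.ofReal_mul (by norm_num)]
        congr 1
        rw [show (Fintype.card ι : ℝ) * (Δ / 2) ^ 2 / 2 = Fintype.card ι * Δ ^ 2 / 8 by ring]
        ring

end Symmetrization

/-! ### Stability of quotients under additive errors. -/

section Ratios

/-- A quotient changes by at most the factor `(lam - α) / (lam + α)` when numerator and
denominator, both at least `lam`, change by at most `α`. -/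
theorem mul_div_le_div_of_close {a b a' b' α lam : ℝ} (hα : 0 ≤ α) (hlam : α < lam)
    (ha : lam ≤ a) (hb : lam ≤ b) (haa : |a' - a| ≤ α) (hbb : |b' - b| ≤ α) :
    (lam - α) / (lam + α) * (a / b) ≤ a' / b' ∧ (lam - α) / (lam + α) * (a' / b') ≤ a / b := by
  rw [abs_le] at haa hbb
  -- As a, b ≥ lam, the additive error α is a relative error of at most α / lam.
  have h1 : a' * lam ≤ a * (lam + α) := by nlinarith
  have h2 : a * (lam - α) ≤ a' * lam := by nlinarith
  have h3 : b' * lam ≤ b * (lam + α) := by nlinarith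
  have h4 : b * (lam - α) ≤ b' * lam := by nlinarith
  have hlam0 : 0 < lam := hα.trans_lt hlam
  have ha0 : 0 < a := by linarith
  have hb0 : 0 < b := by linarith
  have ha'0 : 0 < a' := by linarith
  have hb'0 : 0 < b' := by linarith
  have hs : 0 < lam - α := by linarith
  have ht : 0 < lam + α := by linarith
  constructor
  · rw [div_mul_div_comm, div_le_div_iff₀ (by positivity) hb'0]
    refine le_of_mul_le_mul_right ?_ hlam0
    calc (lam - α) * a * b' * lam = (a * (lam - α)) * (b' * lam) := by ring
      _ ≤ (a' * lam) * (b * (lam + α)) := by gcongr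
      _ = _ := by ring
  · rw [div_mul_div_comm, div_le_div_iff₀ (by positivity) hb0]
    refine le_of_mul_le_mul_right ?_ hlam0
    calc (lam - α) * a' * b * lam = (a' * lam) * (b * (lam - α)) := by ring
      _ ≤ (a * (lam + α)) * (b' * lam) := by gcongr
      _ = _ := by ring

/-- The factor r is lost once in the minimum and once in the maximum, hence the square. -/
theorem sq_mul_iInf_div_iSup_le {ι : Type*} [Finite ι] [Nonempty ι] {q q' : ι → ℝ} {r : ℝ}
    (hr : 0 < r) (hq : ∀ i, 0 < q i) (h1 : ∀ i, r * q i ≤ q' i) (h2 : ∀ i, r * q' i ≤ q i) :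
    r ^ 2 * ((⨅ i, q i) / ⨆ i, q i) ≤ (⨅ i, q' i) / ⨆ i, q' i := by
  have hq' : ∀ i, 0 < q' i := fun i => (mul_pos hr (hq i)).trans_le (h1 i)
  have hb : ∀ g : ι → ℝ, BddAbove (Set.range g) := fun g => (Set.finite_range g).bddAbove
  have hb' : ∀ g : ι → ℝ, BddBelow (Set.range g) := fun g => (Set.finite_range g).bddBelow
  obtain ⟨i₀⟩ := ‹Nonempty ι›
  have hS : 0 < ⨆ i, q i := (hq i₀).trans_le (le_ciSup (hb q) i₀)
  have hS' : 0 < ⨆ i, q' i := (hq' i₀).trans_le (le_ciSup (hb q') i₀)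
  have hI0 : 0 ≤ ⨅ i, q i := Real.iInf_nonneg fun i => (hq i).le
  have hI : r * ⨅ i, q i ≤ ⨅ i, q' i := le_ciInf fun i =>
    (mul_le_mul_of_nonneg_left (ciInf_le (hb' q) i) hr.le).trans (h1 i)
  have hSS : r * ⨆ i, q' i ≤ ⨆ i, q i := by
    rw [← le_div_iff₀' hr]
    refine ciSup_le fun i => ?_
    rw [le_div_iff₀' hr]
    exact (h2 i).trans (le_ciSup (hb q) i)
  rw [← mul_div_assoc, div_le_div_iff₀ hS hS']
  calc r ^ 2 * (⨅ i, q i) * (⨆ i, q' i) = (r * ⨅ i, q i) * (r * ⨆ i, q' i) := by ring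
    _ ≤ (⨅ i, q' i) * ⨆ i, q i :=
      mul_le_mul hI hSS (mul_nonneg hr.le hS'.le) ((mul_nonneg hr.le hI0).trans hI)

end Ratios

/-! ### Guarantees of the program on samples close to the true distribution. -/

section Deterministic

variable {X : Type u} {p : ℕ}

/-- The events that the program refers to: misclassification, `ℰ ∩ ℰ' ∩ {Z = ℓ}` and
`ℰ' ∩ {Z = ℓ}`. -/
def programEvents (E E' : Set (Bool × Point X p)) :
    Option (Fin p × Bool) → Set (Bool × Point X p)
  | none => {v | v.1 ≠ v.2.2.1}
  | some (ℓ, true) => E ∩ E' ∩ {v | v.2.2.2 = ℓ}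
  | some (ℓ, false) => E' ∩ {v | v.2.2.2 = ℓ}

theorem abs_sum_score_sub_le {N : ℕ} (s t : Fin N → Point X p) (G : Set (Bool × Point X p))
    (f : Classifier X p) :
    |∑ i, score G f (t i) - ∑ i, score G f (s i)| ≤ ({i | t i ≠ s i}.ncard : ℝ) := by
  classical
  rw [← Finset.sum_sub_distrib]
  refine (Finset.abs_sum_le_sum_abs _ _).trans ?_
  have : ∀ i, |score G f (t i) - score G f (s i)| ≤ if t i ≠ s i then 1 else 0 := by
    intro i
    split_ifs with h
    · exact abs_indicator_one_sub_le G _ _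
    · rw [not_not.1 h]; simp
  refine (Finset.sum_le_sum fun i _ => this i).trans ?_
  rw [Finset.sum_boole, Set.ncard_eq_toFinset_card']
  simp

variable [MeasurableSpace X]

theorem measurableSet_programEvents {E E' : Set (Bool × Point X p)} (hE : MeasurableSet E)
    (hE' : MeasurableSet E') (k : Option (Fin p × Bool)) :
    MeasurableSet (programEvents E E' k) := by
  have hZ : ∀ ℓ : Fin p, MeasurableSet {v : Bool × Point X p | v.2.2.2 = ℓ} := fun ℓ =>
    measurable_snd.snd.snd (measurableSet_singleton ℓ)
  match k with
  | none => exact (measurableSet_eq_fun measurable_fst measurable_snd.snd.fst).compl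
  | some (ℓ, true) => exact (hE.inter hE').inter (hZ ℓ)
  | some (ℓ, false) => exact hE'.inter (hZ ℓ)

/-- Measures that assign nearly the same probability to the events of the program. -/
def ProgramClose (F : Set (Classifier X p)) (E E' : Set (Bool × Point X p)) (α : ℝ)
    (μ ν : Measure (Point X p)) : Prop :=
  ∀ f ∈ F, ∀ k, |ν.real (eventOf (programEvents E E' k) f) -
    μ.real (eventOf (programEvents E E' k) f)| ≤ α

theorem ProgramClose.symm {F : Set (Classifier X p)} {E E' : Set (Bool × Point X p)} {α : ℝ}
    {μ ν : Measure (Point X p)} (h : ProgramClose F E E' α μ ν) : ProgramClose F E E' α ν μ :=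
  fun f hf k => by rw [abs_sub_comm]; exact h f hf k

theorem ProgramClose.err {F : Set (Classifier X p)} {E E' : Set (Bool × Point X p)} {α : ℝ}
    {μ ν : Measure (Point X p)} (h : ProgramClose F E E' α μ ν) {f : Classifier X p}
    (hf : f ∈ F) : |err ν f - err μ f| ≤ α := h f hf none

theorem ProgramClose.jointProb {F : Set (Classifier X p)} {E E' : Set (Bool × Point X p)} {α : ℝ}
    {μ ν : Measure (Point X p)} (h : ProgramClose F E E' α μ ν) {f : Classifier X p}
    (hf : f ∈ F) (ℓ : Fin p) : |jointProb E E' ν f ℓ - jointProb E E' μ f ℓ| ≤ α :=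
  h f hf (some (ℓ, true))

theorem performance_eq {E E' : Set (Bool × Point X p)} (hE' : MeasurableSet E')
    (μ : Measure (Point X p)) {f : Classifier X p} (hf : Measurable f) (ℓ : Fin p) :
    performance E E' μ f ℓ =
      jointProb E E' μ f ℓ / μ.real (eventOf E' f ∩ groupEvent X ℓ) := by
  have hm : MeasurableSet (eventOf E' f ∩ groupEvent X ℓ) :=
    (measurableSet_eventOf hE' hf).inter (measurable_snd.snd (measurableSet_singleton ℓ))
  rw [performance, jointProb, Measure.real, ProbabilityTheory.cond_apply hm, ENNReal.toReal_mul,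
    ENNReal.toReal_inv, div_eq_inv_mul, Set.inter_assoc (eventOf E f),
    Set.inter_comm (eventOf E f)]
  rfl

theorem fairness_nonneg (E E' : Set (Bool × Point X p)) (μ : Measure (Point X p))
    (f : Classifier X p) : 0 ≤ fairness E E' μ f :=
  div_nonneg (Real.iInf_nonneg fun _ => measureReal_nonneg)
    (Real.iSup_nonneg fun _ => measureReal_nonneg)

/-- Only μ needs a floor on the joint probabilities. Hence it applies both from the true to the
empirical distribution (for `fStar`, floor `lam`) and back (for the optimum, floor `lam - η - Δ`).
-/
theorem fairness_of_close {F : Set (Classifier X p)} {E E' : Set (Bool × Point X p)}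
    (hE' : MeasurableSet E') {α lam : ℝ} {μ ν : Measure (Point X p)} [IsFiniteMeasure μ]
    [Nonempty (Fin p)] (h : ProgramClose F E E' α μ ν) {f : Classifier X p}
    (hf : f ∈ F) (hfm : Measurable f) (hα : 0 ≤ α) (hlam : α < lam)
    (hl : ∀ ℓ, lam ≤ jointProb E E' μ f ℓ) :
    ((lam - α) / (lam + α)) ^ 2 * fairness E E' μ f ≤ fairness E E' ν f := by
  have hle : ∀ ℓ, jointProb E E' μ f ℓ ≤ μ.real (eventOf E' f ∩ groupEvent X ℓ) := fun ℓ =>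
    measureReal_mono (Set.inter_subset_inter_left _ Set.inter_subset_right)
  have key := fun ℓ => mul_div_le_div_of_close hα hlam (hl ℓ) ((hl ℓ).trans (hle ℓ))
    (h.jointProb hf ℓ) (h f hf (some (ℓ, false)))
  refine sq_mul_iInf_div_iSup_le (div_pos (by linarith) (by linarith)) (fun ℓ => ?_)
    (fun ℓ => ?_) (fun ℓ => ?_)
  · rw [performance_eq hE' μ hfm]
    have := hl ℓ
    exact div_pos (by linarith) (by linarith [hle ℓ])
  · rw [performance_eq hE' μ hfm, performance_eq hE' ν hfm]
    exact (key ℓ).1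
  · rw [performance_eq hE' μ hfm, performance_eq hE' ν hfm]
    exact (key ℓ).2

theorem empirical_real_apply {N : ℕ} (s : Fin N → Point X p) {A : Set (Point X p)}
    (hA : MeasurableSet A) :
    (empirical s).real A = (∑ i, A.indicator (1 : Point X p → ℝ) (s i)) / N := by
  rw [empirical, measureReal_ennreal_smul_apply, ENNReal.toReal_inv, ENNReal.toReal_natCast,
    div_eq_inv_mul, measureReal_def, Measure.finsetSum_apply, ENNReal.toReal_sum]
  · congr 1
    refine Finset.sum_congr rfl fun i _ => ?_
    rw [Measure.dirac_apply' _ hA]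
    by_cases h : s i ∈ A <;> simp [h]
  · exact fun i _ => measure_ne_top _ _

/-- Empirical errors lie in the finite set of fractions k / N with k ≤ N, so the minimum is attained
even if F is infinite. -/
theorem exists_isErrTolerantOpt {F : Set (Classifier X p)} {E E' : Set (Bool × Point X p)}
    {τ η lam Δ : ℝ} {N : ℕ} {s : Fin N → Point X p} {f : Classifier X p}
    (hm : ∀ g ∈ F, Measurable g) (hf : ErrTolerantFeasible F E E' τ η lam Δ s f) :
    ∃ g, IsErrTolerantOpt F E E' τ η lam Δ s g := by
  classical
  have herr : ∀ g ∈ F, err (empirical s) g ∈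
      (fun k : ℕ => (k : ℝ) / N) '' (Finset.range (N + 1) : Set ℕ) := by
    intro g hg
    have hmeas : MeasurableSet {w | predict g w ≠ w.2.1} :=
      (measurableSet_eq_fun (measurable_predict (hm g hg)) measurable_snd.fst).compl
    refine ⟨(Finset.univ.filter fun i => s i ∈ {w | predict g w ≠ w.2.1}).card, ?_, ?_⟩
    · have := Finset.card_le_univ
        (Finset.univ.filter fun i => s i ∈ {w | predict g w ≠ w.2.1})
      rw [Fintype.card_fin] at this
      exact Finset.mem_coe.2 (Finset.mem_range.2 (Nat.lt_succ_of_le this))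
    · simp only [err]
      rw [empirical_real_apply s hmeas]
      simp only [Set.indicator_apply, Pi.one_apply, Finset.sum_boole]
  have hfin : (err (empirical s) '' {g | ErrTolerantFeasible F E E' τ η lam Δ s g}).Finite := by
    refine ((Finset.finite_toSet (Finset.range (N + 1))).image
      (fun k : ℕ => (k : ℝ) / N)).subset ?_
    rintro _ ⟨g, hg, rfl⟩
    exact herr g hg.mem
  obtain ⟨_, ⟨g, hg, rfl⟩, hmin⟩ := hfin.exists_minimal ⟨_, f, hf, rfl⟩
  refine ⟨g, hg, fun g' hg' => ?_⟩
  by_contra hlt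
  exact hlt (hmin ⟨g', hg', rfl⟩ (not_le.1 hlt).le)

theorem programClose_empirical {F : Set (Classifier X p)} {E E' : Set (Bool × Point X p)}
    (hE : MeasurableSet E) (hE' : MeasurableSet E') (hF : ∀ f ∈ F, Measurable f)
    {μ : Measure (Point X p)} {N : ℕ} (hN : 0 < N) {η Δ : ℝ} {s t : Fin N → Point X p}
    (hst : ({i | t i ≠ s i}.ncard : ℝ) ≤ η * N)
    (hs : ∀ k, s ∉ deviationEvent F μ (programEvents E E' k) Δ (Fin N)) :
    ProgramClose F E E' (η + Δ) μ (empirical t) := by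
  intro f hf k
  have hN' : (0 : ℝ) < N := Nat.cast_pos.2 hN
  have h1 : |∑ i, score (programEvents E E' k) f (s i) -
      N * μ.real (eventOf (programEvents E E' k) f)| ≤ Δ * N := by
    by_contra h
    exact hs k ⟨f, hf, by simpa using h⟩
  have h2 := (abs_sum_score_sub_le s t (programEvents E E' k) f).trans hst
  rw [empirical_real_apply t
    (measurableSet_eventOf (measurableSet_programEvents hE hE' k) (hF f hf)),
    ← score_eq_indicator, div_sub' hN'.ne', abs_div, abs_of_pos hN', div_le_iff₀ hN']
  have := abs_sub_le (∑ i, score (programEvents E E' k) f (t i))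
    (∑ i, score (programEvents E E' k) f (s i))
    (N * μ.real (eventOf (programEvents E E' k) f))
  linarith

theorem one_sub_two_mul_le_div {x : ℝ} (hx : 0 ≤ x) : 1 - 2 * x ≤ (1 - x) / (1 + x) := by
  rw [le_div_iff₀ (by linarith)]
  nlinarith

/-- The program succeeds on every perturbed sample that is close to the true distribution. -/
theorem errTolerant_guarantee {F : Set (Classifier X p)} {E E' : Set (Bool × Point X p)}
    (hE' : MeasurableSet E') (hF : ∀ f ∈ F, Measurable f) {μ : Measure (Point X p)}
    [IsProbabilityMeasure μ] [Nonempty (Fin p)] {lam η τ ε ν Δ : ℝ} {fStar : Classifier X p}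
    (hτ : τ ∈ Set.Ioc 0 1) (hopt : IsOptimalFair F E E' τ μ fStar) (hlam : 0 < lam)
    (hjoint : ∀ ℓ, lam ≤ jointProb E E' μ fStar ℓ) (hη : η ∈ Set.Ioo 0 (lam / 2))
    (hε : 2 * η < ε) (hν : 8 * η * τ / (lam - 2 * η) < ν) (hΔ : 0 < Δ)
    (hΔ1 : Δ ≤ lam - 2 * η)
    (hΔ2 : Δ ≤ (lam - 2 * η) ^ 2 / 96 * min (ε - 2 * η) (ν - 8 * η * τ / (lam - 2 * η)))
    {N : ℕ} (hN : 0 < N) {t : Fin N → Point X p}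
    (h : ProgramClose F E E' (η + Δ) μ (empirical t)) :
    (∃ f, IsErrTolerantOpt F E E' τ η lam Δ t f) ∧
      ∀ f, IsErrTolerantOpt F E E' τ η lam Δ t f →
        err μ f - err μ fStar ≤ ε ∧ τ - ν ≤ fairness E E' μ f := by
  obtain ⟨hη0, hη1⟩ := hη
  obtain ⟨hτ0, hτ1⟩ := hτ
  obtain ⟨ℓ₀⟩ := ‹Nonempty (Fin p)›
  have hlam1 : lam ≤ 1 := (hjoint ℓ₀).trans measureReal_le_one
  have : Nonempty (Fin p) := ⟨ℓ₀⟩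
  -- Here N > 0 matters: otherwise the weight (N)⁻¹ is infinite.
  have : IsFiniteMeasure (empirical t) := by
    refine ⟨?_⟩
    rw [empirical, Measure.smul_apply, smul_eq_mul]
    exact ENNReal.mul_lt_top (by simp [hN]) (measure_lt_top _ _)
  set L := lam - 2 * η with hL
  have hL0 : 0 < L := by linarith
  have hL1 : L ≤ 1 := by linarith
  have hfeas : ErrTolerantFeasible F E E' τ η lam Δ t fStar := by
    refine ⟨hopt.mem, ?_, fun ℓ => ?_⟩
    · have h1 := fairness_of_close hE' h hopt.mem (hF _ hopt.mem) (by linarith)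
        (by linarith) hjoint
      have h2 : (1 - (η + Δ) / lam) / (1 + (η + Δ) / lam) =
          (lam - (η + Δ)) / (lam + (η + Δ)) := by
        field_simp
      rw [h2, mul_comm]
      exact (mul_le_mul_of_nonneg_left hopt.fair (sq_nonneg _)).trans h1
    · have := abs_le.1 (h.jointProb hopt.mem ℓ)
      linarith [hjoint ℓ, this.1]
  refine ⟨exists_isErrTolerantOpt hF hfeas, fun f hf => ⟨?_, ?_⟩⟩
  · have h1 := abs_le.1 (h.err hf.1.mem)
    have h2 := abs_le.1 (h.err hopt.mem)
    have h3 := hf.2 _ hfeas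
    have h4 : Δ ≤ L ^ 2 / 96 * (ε - 2 * η) :=
      hΔ2.trans (mul_le_mul_of_nonneg_left (min_le_left _ _) (by positivity))
    have h5 : L ^ 2 / 96 ≤ 1 / 2 := by nlinarith
    have h6 := mul_le_mul_of_nonneg_right h5 (sub_nonneg.2 hε.le)
    linarith [h1.1, h2.2]
  -- If τ ≤ ν the claim is trivial; otherwise ν < τ ≤ 1, which bounds the slack M by 1 and yields
  -- 2(η + Δ) < lam.
  · rcases le_or_gt τ ν with hτν | hτν
    · exact (sub_nonpos.2 hτν).trans (fairness_nonneg _ _ _ _)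
    set M := ν - 8 * η * τ / L with hM
    have hM0 : 0 < M := sub_pos.2 hν
    have hM1 : M ≤ 1 := by
      have : 0 ≤ 8 * η * τ / L := by positivity
      linarith
    have hΔM : Δ ≤ L ^ 2 / 96 * M :=
      hΔ2.trans (mul_le_mul_of_nonneg_left (min_le_right _ _) (by positivity))
    have hΔL : 2 * Δ < L := by
      have h1 : L ^ 2 / 96 * M ≤ L ^ 2 / 96 := mul_le_of_le_one_right (by positivity) hM1
      nlinarith
    have hr := fairness_of_close hE' h.symm hf.1.mem (hF _ hf.1.mem) (lam := lam - η - Δ)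
      (by linarith) (by linarith) hf.1.lower
    set x := (η + Δ) / lam with hx
    have hxl : x * lam = η + Δ := by rw [hx]; field_simp
    have hx0 : 0 ≤ x := by positivity
    have hx1 : 0 ≤ 1 - 2 * x := by
      have : 0 ≤ (1 - 2 * x) * lam := by rw [sub_mul, mul_assoc, hxl]; linarith
      exact nonneg_of_mul_nonneg_left this hlam
    have hratio : (lam - η - Δ - (η + Δ)) / (lam - η - Δ + (η + Δ)) = 1 - 2 * x := by
      rw [show lam - η - Δ + (η + Δ) = lam by ring, div_eq_iff hlam.ne', sub_mul, mul_assoc, hxl]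
      ring
    rw [hratio] at hr
    have h1 : (1 - 2 * x) ^ 2 ≤ ((1 - x) / (1 + x)) ^ 2 :=
      pow_le_pow_left₀ hx1 (one_sub_two_mul_le_div hx0) 2
    -- Bernoulli's inequality; one square comes from the relaxed constraint, the other from the
    -- transfer back to μ.
    have h2 : 1 - 8 * x ≤ (1 - 2 * x) ^ 2 * (1 - 2 * x) ^ 2 := by
      nlinarith [sq_nonneg x, sq_nonneg (1 - 2 * x), mul_nonneg hx0 hx0, sq_nonneg (x - x ^ 2)]
    -- The η part of x uses up 8ητ / L, and the Δ part fits into the slack M.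
    have h3 : 8 * x * τ ≤ ν := by
      have h4 : 8 * (η / lam) * τ ≤ 8 * η * τ / L := by
        rw [show 8 * (η / lam) * τ = 8 * η * τ / lam by ring]
        exact div_le_div_of_nonneg_left (by positivity) hL0 (by linarith)
      have h5 : 8 * (Δ / lam) * τ ≤ M := by
        have h6 : Δ / lam ≤ L / 96 * M := by
          rw [div_le_iff₀ hlam]
          refine hΔM.trans ?_
          rw [show L ^ 2 / 96 * M = L / 96 * M * L by ring]
          exact mul_le_mul_of_nonneg_left (by linarith) (by positivity)
        have h7 : Δ / lam ≤ M / 96 := h6.trans (by nlinarith)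
        have h8 : 0 ≤ Δ / lam := by positivity
        nlinarith
      have : 8 * x * τ = 8 * (η / lam) * τ + 8 * (Δ / lam) * τ := by rw [hx]; ring
      linarith
    calc τ - ν ≤ τ * (1 - 8 * x) := by linarith
      _ ≤ τ * ((1 - 2 * x) ^ 2 * (1 - 2 * x) ^ 2) := by gcongr
      _ = (1 - 2 * x) ^ 2 * (τ * (1 - 2 * x) ^ 2) := by ring
      _ ≤ (1 - 2 * x) ^ 2 * (τ * ((1 - x) / (1 + x)) ^ 2) := by gcongr
      _ ≤ (1 - 2 * x) ^ 2 * fairness E E' (empirical t) f := by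
          gcongr; exact hf.1.fair
      _ ≤ _ := hr

end Deterministic

/-! ### The sample size. -/

section SampleComplexity

/-- The number of samples as a polynomial in `d`, `1 / Δ` and `log (p / δ)`. -/
noncomputable def sampleComplexity : MvPolynomial (Fin 3) ℝ :=
  -- The terms pay, in order, for the growth function, the union bound over events, the Chebyshev
  -- step, and N > 0.
  4096 * .X 0 ^ 2 * .X 1 ^ 4 + 16 * .X 1 ^ 2 * (11 + .X 2) + 2 * .X 1 ^ 2 + 1

theorem eval_sampleComplexity (a b c : ℝ) : MvPolynomial.eval ![a, b, c] sampleComplexity =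
    4096 * a ^ 2 * b ^ 4 + 16 * b ^ 2 * (11 + c) + 2 * b ^ 2 + 1 := by
  simp [sampleComplexity]

theorem card_mul_deviation_bound_le {N p d : ℕ} {Δ δ : ℝ} (hp : 0 < p) (hΔ : 0 < Δ) (hδ : 0 < δ)
    (h1 : 4096 * (d : ℝ) ^ 2 * (1 / Δ) ^ 4 ≤ N)
    (h2 : 16 * (1 / Δ) ^ 2 * (11 + Real.log (p / δ)) ≤ N) :
    (2 * p + 1) * (4 * (2 * (N : ℝ) + 1) ^ d * Real.exp (-(N * Δ ^ 2 / 8))) ≤ δ := by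
  have hp' : (1 : ℝ) ≤ p := by exact_mod_cast hp
  have hs := Real.sq_sqrt (Nat.cast_nonneg (α := ℝ) N)
  set s := Real.sqrt N
  have hs0 : 0 ≤ s := Real.sqrt_nonneg _
  -- Bounding log(2N + 1) by 4√N keeps the condition on N polynomial. Half of the exponent NΔ²/8
  -- absorbs 4d√N, the other half 11 + log(p/δ).
  have ha : 2 * (N : ℝ) + 1 ≤ Real.exp (4 * s) := by
    have := Real.quadratic_le_exp_of_nonneg (x := 4 * s) (by positivity)
    nlinarith
  have hb : 4 * s * d ≤ N * Δ ^ 2 / 16 := by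
    have hsd : 64 * d * (1 / Δ) ^ 2 ≤ s := by
      refine Real.le_sqrt_of_sq_le ?_
      calc _ = 4096 * (d : ℝ) ^ 2 * (1 / Δ) ^ 4 := by ring
        _ ≤ _ := h1
    have hsd' : 64 * d ≤ s * Δ ^ 2 := by
      rwa [one_div, inv_pow, ← div_eq_mul_inv, div_le_iff₀ (by positivity)] at hsd
    rw [← hs]
    nlinarith
  have hc : 11 + Real.log (p / δ) ≤ N * Δ ^ 2 / 16 := by
    rw [one_div, inv_pow, mul_right_comm, ← div_eq_mul_inv, div_le_iff₀ (by positivity)] at h2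
    linarith
  have hlog : (p : ℝ) = δ * Real.exp (Real.log (p / δ)) := by
    rw [Real.exp_log (by positivity)]; field_simp
  have h12 : (12 : ℝ) ≤ Real.exp 11 := by
    have := Real.add_one_le_exp (11 : ℝ); linarith
  calc (2 * p + 1) * (4 * (2 * (N : ℝ) + 1) ^ d * Real.exp (-(N * Δ ^ 2 / 8)))
      ≤ (3 * p) * (4 * Real.exp (4 * s) ^ d * Real.exp (-(N * Δ ^ 2 / 8))) := by
        gcongr; linarith
    _ = p * 12 * (Real.exp (4 * s) ^ d * Real.exp (-(N * Δ ^ 2 / 8))) := by ring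
    _ ≤ p * Real.exp 11 * (Real.exp (4 * s) ^ d * Real.exp (-(N * Δ ^ 2 / 8))) := by gcongr
    _ = δ * Real.exp (Real.log (p / δ) + 11 + d * (4 * s) + -(N * Δ ^ 2 / 8)) := by
        rw [Real.exp_add, Real.exp_add, Real.exp_add, Real.exp_nat_mul]
        nth_rewrite 1 [hlog]
        ring
    _ ≤ δ * Real.exp 0 := by
        gcongr
        linarith
    _ = δ := by simp

end SampleComplexity

end FairClassification

/-! ### The theorem: a union bound over the program's events. -/

theorem mainTheorem6 :
    ∃ poly : MvPolynomial (Fin 3) ℝ,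
      ∀ (X : Type u) [MeasurableSpace X] (p d : ℕ)
        (𝒟 : Measure (FairClassification.Point X p)) [IsProbabilityMeasure 𝒟]
        (F : Set (FairClassification.Classifier X p))
        (E E' : Set (Bool × FairClassification.Point X p))
        (lam η τ ε ν δ Δ : ℝ) (fStar : FairClassification.Classifier X p),
        FairClassification.IsMeasurableClass F 𝒟 →
        FairClassification.HasVCDim F d →
        MeasurableSet E → MeasurableSet E' →
        τ ∈ Set.Ioc 0 1 →
        FairClassification.IsOptimalFair F E E' τ 𝒟 fStar →
        0 < lam →
        (∀ ℓ, lam ≤ FairClassification.jointProb E E' 𝒟 fStar ℓ) →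
        η ∈ Set.Ioo 0 (lam / 2) →
        2 * η < ε →
        8 * η * τ / (lam - 2 * η) < ν →
        δ ∈ Set.Ioo 0 1 →
        0 < Δ →
        Δ ≤ lam - 2 * η →
        Δ ≤ (lam - 2 * η) ^ 2 / 96 * min (ε - 2 * η) (ν - 8 * η * τ / (lam - 2 * η)) →
        ∀ N : ℕ, MvPolynomial.eval ![(d : ℝ), 1 / Δ, Real.log (p / δ)] poly ≤ N →
          ∀ (Ω : Type v) [MeasurableSpace Ω] (P : Measure Ω) [IsProbabilityMeasure P]
            (S T : Ω → Fin N → FairClassification.Point X p),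
            FairClassification.IsNastyNoise P 𝒟 η S T →
            P {ω | ¬ ((∃ f, FairClassification.IsErrTolerantOpt F E E' τ η lam Δ (T ω) f) ∧
                ∀ f, FairClassification.IsErrTolerantOpt F E E' τ η lam Δ (T ω) f →
                  FairClassification.err 𝒟 f - FairClassification.err 𝒟 fStar ≤ ε ∧
                  τ - ν ≤ FairClassification.fairness E E' 𝒟 f)} ≤ ENNReal.ofReal δ := by
  open FairClassification in
  refine ⟨sampleComplexity, ?_⟩
  intro X _ p d 𝒟 _ F E E' lam η τ ε ν δ Δ fStar hF hd hE hE' hτ hopt hlam hjoint hη hε hν hδ hΔ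
    hΔ1 hΔ2 N hN Ω _ P _ S T hST
  obtain ⟨w⟩ := 𝒟.nonempty_of_neZero
  have : Nonempty (Fin p) := ⟨w.2.2⟩
  have hp : 0 < p := Fin.pos w.2.2
  rw [eval_sampleComplexity] at hN
  have hlog : 0 ≤ Real.log (p / δ) := by
    refine Real.log_nonneg ((one_le_div hδ.1).2 (hδ.2.le.trans ?_))
    exact_mod_cast hp
  have hx1 : 0 ≤ 4096 * (d : ℝ) ^ 2 * (1 / Δ) ^ 4 := by positivity
  have hx2 : 0 ≤ 16 * (1 / Δ) ^ 2 * (11 + Real.log (p / δ)) := by positivity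
  have hx3 : 0 ≤ 2 * (1 / Δ) ^ 2 := by positivity
  have hN0 : 0 < N := by
    have : (0 : ℝ) < N := by linarith
    exact_mod_cast this
  set C : ℝ := 4 * (2 * (N : ℝ) + 1) ^ d * Real.exp (-(N * Δ ^ 2 / 8))
  have hdev : ∀ k, P (S ⁻¹' deviationEvent F 𝒟 (programEvents E E' k) Δ (Fin N)) ≤
      ENNReal.ofReal C := by
    intro k
    -- This direction of the comparison with the law of S holds for arbitrary, possibly
    -- non-measurable sets.
    refine (Measure.le_map_apply hST.law.aemeasurable _).trans ?_
    rw [hST.law.map_eq]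
    refine (measure_deviationEvent_le hF hd (measurableSet_programEvents hE hE' k) hΔ (Fin N)
      ?_).trans_eq (by rw [Fintype.card_fin])
    rw [Fintype.card_fin, ← mul_one_div, ← one_div_pow]
    linarith
  calc _ ≤ P ({ω | ¬ (({i | T ω i ≠ S ω i}.ncard : ℝ) ≤ η * N)} ∪
        ⋃ k, S ⁻¹' deviationEvent F 𝒟 (programEvents E E' k) Δ (Fin N)) := by
        refine measure_mono fun ω hω => ?_
        by_contra hgood
        rw [Set.mem_union, not_or, Set.mem_iUnion, not_exists] at hgood
        exact hω (errTolerant_guarantee hE' hF.measurable hτ hopt hlam hjoint hη hε hν hΔ hΔ1 hΔ2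
          hN0 (programClose_empirical hE hE' hF.measurable hN0 (not_not.1 hgood.1) hgood.2))
    _ ≤ 0 + ∑ k, P (S ⁻¹' deviationEvent F 𝒟 (programEvents E E' k) Δ (Fin N)) := by
        refine (measure_union_le _ _).trans ?_
        gcongr
        · exact (ae_iff.1 hST.budget).le
        · exact measure_iUnion_fintype_le _ _
    _ ≤ ∑ _k : Option (Fin p × Bool), ENNReal.ofReal C := by
        rw [zero_add]; exact Finset.sum_le_sum fun k _ => hdev k
    _ = ENNReal.ofReal ((2 * p + 1) * C) := by
        rw [ENNReal.ofReal_mul (p := 2 * (p : ℝ) + 1) (by positivity), Finset.sum_const,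
          Finset.card_univ, nsmul_eq_mul, ← ENNReal.ofReal_natCast]
        congr 2
        rw [Fintype.card_option, Fintype.card_prod, Fintype.card_fin, Fintype.card_bool]
        push_cast
        ring
    _ ≤ _ := ENNReal.ofReal_le_ofReal
        (card_mul_deviation_bound_le hp hΔ hδ.1 (by linarith) (by linarith))
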